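/- **Theorem 1.8.** A *polygonal region* is a bounded set $P\subset\mathbb R^2$ whose interior is nonempty and connected, which is contained in the closure of its interior, and whose boundary is a finite union of line segments ($P$ may contain any part of its boundary). Let $\omega\subset\mathbb R^2$ be open and connected and let $n_0:\omega\to\mathbb S^2$. Suppose there are finitely many, and at least two, mutually disjoint polygonal regions $\omega_1,\dots,\omega_N\subset\omega$ with $|\omega\setminus\bigcup_\alpha\omega_\alpha|=0$ and vectors $n_{01},\dots,n_{0N}\in\mathbb S^2$ such that $n_0\equiv n_{0\alpha}$ on $\omega_\alpha$ for every $\alpha$, and such that $\tilde n_{0\alpha}\neq\pm\tilde n_{0\beta}$ whenever $\alpha\ne\beta$ and there is an interface between $\omega_\alpha$ and $\omega_\beta$, i.e. a line segment of positive length contained in $\omega\cap\overline{\omega_\alpha}\cap\overline{\omega_\beta}$. Here $\tilde n\in\mathbb R^2$ denotes the first two components of $n\in\mathbb R^3$. Let $r>0$, $r\neq1$, and put $\tilde\ell_{n_0}=r^{-1/3}\bigl(I_{2\times2}+(r-1)\,\tilde n_0\otimes\tilde n_0\bigr)$. For $h>0$ and $y\in W^{2,2}(\omega,\mathbb R^3)$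 let $$\tilde{\mathcal I}^h_{n_0}(y)=h\int_\omega\Bigl(\bigl|(\nabla y)^T\nabla y-\tilde\ell_{n_0}\bigr|^2+h^2|\nabla\nabla y|^2\Bigr)\,dx\in[0,\infty],$$ where $|\cdot|$ is the Euclidean (Frobenius) norm. Then there are constants $c_L>0$ and $h_0>0$, depending only on $n_0$, $r$ and $\omega$, such that for all $0<h<h_0$ $$\inf\bigl\{\tilde{\mathcal I}^h_{n_0}(y)\;:\;y\in W^{2,2}(\omega,\mathbb R^3)\bigr\}\ \ge\ c_L\,h^2 .$$ -/

import Mathlib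

open MeasureTheory
open scoped ENNReal

noncomputable section

/-- `Plane` is the Euclidean plane, in which the midplane `ω` of the sheet lies. -/
abbrev Plane : Type := EuclideanSpace ℝ (Fin 2)

/-- `Space` is Euclidean three-space, the target of deformations and of directors. -/
abbrev Space : Type := EuclideanSpace ℝ (Fin 3)

/-- The projection `ñ ∈ ℝ²` of a vector `n ∈ ℝ³` onto the plane of the sheet. -/
def planarPart (n : Space) : Fin 2 → ℝ := ![n 0, n 1]

/-- The two-dimensional metric `r^(-1/3) (I + (r - 1) ñ ⊗ ñ)`. -/
def midplaneMetric (r : ℝ) (n : Space) : Matrix (Fin 2) (Fin 2) ℝ :=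
  r ^ (-(1 / 3 : ℝ)) •
    (1 + (r - 1) • Matrix.vecMulVec (planarPart n) (planarPart n))

/-- The squared Euclidean (Frobenius) norm of a matrix. -/
def frobeniusSq {m n : Type*} [Fintype m] [Fintype n] (A : Matrix m n ℝ) : ℝ :=
  ∑ i, ∑ j, A i j ^ 2

/-! ### Designs -/

/-- A polygonal region: a bounded planar set with nonempty connected interior, whose boundary
consists of finitely many line segments, and which is contained in the closure of its interior.
It may contain any part of its boundary. -/
structure IsPolygonalRegion (P : Set Plane) : Prop where
  isBounded : Bornology.IsBounded P
  isConnected_interior : IsConnected (interior P)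
  subset_closure_interior : P ⊆ closure (interior P)
  frontier_eq : ∃ (m : ℕ) (a b : Fin m → Plane), frontier P = ⋃ k, segment ℝ (a k) (b k)

/-- Two parts `P`, `Q` of `ω` have an interface if some nondegenerate line segment lies in `ω` and
in the boundary between `P` and `Q`. -/
def HasInterface (ω P Q : Set Plane) : Prop :=
  ∃ a b : Plane, a ≠ b ∧ segment ℝ a b ⊆ ω ∩ closure P ∩ closure Q

/-- A nonisometric origami design `(ω, n₀)`: the planar domain `ω` is, up to a null set (on the
interfaces), the union of at least two mutually disjoint polygonal regions, finite in number, the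
unit director field `n₀` is constant on each of them, and the planar parts of these constants are
neither equal nor opposite whenever two different regions have an interface. -/
structure IsNonisometricOrigamiDesign (ω : Set Plane) (n₀ : Plane → Space) : Prop where
  isOpen : IsOpen ω
  isConnected : IsConnected ω
  norm_director : ∀ x ∈ ω, ‖n₀ x‖ = 1
  exists_cells : ∃ (N : ℕ) (cell : Fin N → Set Plane) (n : Fin N → Space),
    2 ≤ N ∧
    (∀ α, IsPolygonalRegion (cell α)) ∧
    (∀ α β, α ≠ β → Disjoint (cell α) (cell β)) ∧
    (⋃ α, cell α) ⊆ ω ∧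
    volume (ω \ ⋃ α, cell α) = 0 ∧
    (∀ α, ∀ x ∈ cell α, n₀ x = n α) ∧
    (∀ α β, α ≠ β → HasInterface ω (cell α) (cell β) →
      planarPart (n α) ≠ planarPart (n β) ∧ planarPart (n α) ≠ -planarPart (n β))

/-! ### The Sobolev space and the energy -/

/-- `g` is the weak partial derivative `∂ᵢ f` on `ω` of the map `f`: integration by parts holds
against every smooth function whose support is compact and contained in `ω`. -/
def IsWeakPartial (ω : Set Plane) (i : Fin 2) (f g : Plane → Space) : Prop :=
  ∀ φ : Plane → ℝ, ContDiff ℝ ((⊤ : ℕ∞) : WithTop ℕ∞) φ → HasCompactSupport φ → tsupport φ ⊆ ω →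
    ∫ x in ω, (fderiv ℝ φ x (EuclideanSpace.single i 1)) • f x = -∫ x in ω, φ x • g x

/-- A map in the Sobolev space `W^{2,2}(ω, ℝ³)`, with its weak derivatives of first and second
order (which it determines almost everywhere on `ω`): all of them are square integrable on `ω`. -/
structure SobolevMap (ω : Set Plane) where
  /-- the map itself -/
  toFun : Plane → Space
  /-- the weak derivatives `∂ᵢ y` -/
  d : Fin 2 → Plane → Space
  /-- the weak derivatives `∂ⱼ ∂ᵢ y` -/
  dd : Fin 2 → Fin 2 → Plane → Space
  memLp : MemLp toFun 2 (volume.restrict ω)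
  memLp_d : ∀ i, MemLp (d i) 2 (volume.restrict ω)
  memLp_dd : ∀ i j, MemLp (dd i j) 2 (volume.restrict ω)
  isWeakPartial_d : ∀ i, IsWeakPartial ω i toFun (d i)
  isWeakPartial_dd : ∀ i j, IsWeakPartial ω j (d i) (dd i j)

instance (ω : Set Plane) : Inhabited (SobolevMap ω) where
  default :=
    { toFun := fun _ => 0
      d := fun _ _ => 0
      dd := fun _ _ _ => 0
      memLp := MemLp.zero
      memLp_d := fun _ => MemLp.zero
      memLp_dd := fun _ _ => MemLp.zero
      isWeakPartial_d := fun _ _ _ _ _ => by simp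
      isWeakPartial_dd := fun _ _ _ _ _ _ => by simp }

/-- The `3 × 2` gradient matrix of a Sobolev map. -/
def SobolevMap.grad {ω : Set Plane} (y : SobolevMap ω) (x : Plane) : Matrix (Fin 3) (Fin 2) ℝ :=
  Matrix.of fun k i => y.d i x k

/-- The squared norm `|∇∇y|²` of the second gradient of a Sobolev map. -/
def SobolevMap.hessSq {ω : Set Plane} (y : SobolevMap ω) (x : Plane) : ℝ :=
  ∑ i, ∑ j, ∑ k, y.dd i j x k ^ 2

/-- The energy `h ∫_ω (|(∇y)ᵀ ∇y - ℓ̃_{n₀}|² + h² |∇∇y|²)`, with values in `[0, ∞]`. -/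
def plateEnergy (r : ℝ) {ω : Set Plane} (n₀ : Plane → Space) (h : ℝ) (y : SobolevMap ω) : ℝ≥0∞ :=
  ENNReal.ofReal h * ∫⁻ x in ω, ENNReal.ofReal
    (frobeniusSq ((y.grad x).transpose * y.grad x - midplaneMetric r (n₀ x)) + h ^ 2 * y.hessSq x)

end

/-!
The design contains an interface, that is, a nondegenerate boundary segment between two cells on
which the target metrics `A` and `B` differ. A disc around a suitable point of it is split by a
line `{ψ = s}` into two half discs on which the target metric is constant. The bound comes from
this disc alone, by a Modica–Mortola argument for the gradient `F = ∇y` on short segments that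
cross the line.

At the crossing point `FᵀF` is far from `A` or far from `B`, say from `A`. On the side where `A`
is the target metric, either `FᵀF` stays far from `A`, at a cost bounded below independently of
`h`, or `F` has to travel a distance at least `η` (`exists_transition_cost`, by compactness of the
energy wells), at a cost of at least `∫ 2 h √m |F'| ≥ 2 h √m η`; see `le_lintegral_of_transition`
and `le_lintegral_segment`. Either way a segment carries an energy of order `h`, hence so does the
disc, and the prefactor of the energy supplies the second power of `h`. No compatibility of the
metrics along the interface is used: it is enough that they differ.

*Existence of the half discs* (`IsNonisometricOrigamiDesign.exists_half_balls`). If there were no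
interface, the closures of different cells would meet inside `ω` in finitely many points only, and
a disc around such a point would be disconnected by removing a finite set (`exists_hasInterface`).
Along an interface all but finitely many points have a neighbourhood in which the boundaries of
the two cells lie in one line.

*Sobolev maps.* The segments are taken parallel to a coordinate vector transversal to the
interface, so that a single weak derivative is involved. The segment bound is applied to mollified
gradients, whose derivatives have no larger `L²` norm (`lintegral_mollify_sq_le`). Truncating the
potential makes it bounded (`phasePotential`), so that it passes to the limit by dominated
convergence (`le_lintegral_phasePotential`).
-/

open Set Metric Topology Interval
open ContinuousLinearMap (lsmul)
open scoped Convolution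

noncomputable section

/-! ### Geometry of the design: half discs on either side of an interface -/

/-- The disc is homeomorphic to the plane, where the complement of a countable set is connected. -/
theorem isPreconnected_ball_diff_countable (x : Plane) {ρ : ℝ} (hρ : 0 < ρ) {O : Set Plane}
    (hO : O.Countable) : IsPreconnected (ball x ρ \ O) := by
  set e := OpenPartialHomeomorph.univBall x ρ
  have hinj : Function.Injective e := by
    have := e.injOn
    rwa [OpenPartialHomeomorph.univBall_source, injOn_univ] at this
  have h1 : (e ⁻¹' O).Countable := hO.preimage hinj
  have h2 : IsPreconnected (e ⁻¹' O)ᶜ :=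
    (h1.isConnected_compl_of_one_lt_rank (by simp [← Module.finrank_eq_rank])).isPreconnected
  have h3 := h2.image e (OpenPartialHomeomorph.continuous_univBall x ρ).continuousOn
  convert h3 using 1
  have ht : e '' univ = ball x ρ := by
    have := e.image_source_eq_target
    rwa [OpenPartialHomeomorph.univBall_source, OpenPartialHomeomorph.univBall_target x hρ] at this
  rw [← preimage_compl, image_preimage_eq_inter_range, ← image_univ, ht, sdiff_eq, inter_comm]

theorem frontier_of_mem_closure_inter {P Q : Set Plane} (hd : Disjoint P Q)
    {x : Plane} (hxP : x ∈ closure P) (hxQ : x ∈ closure Q) :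
    x ∈ frontier P := by
  refine ⟨hxP, fun hx => ?_⟩
  obtain ⟨y, hy, hy'⟩ := mem_closure_iff.1 hxQ _ isOpen_interior hx
  exact hd.ne_of_mem (interior_subset hy) hy' rfl

theorem diff_finite_nonempty_of_isOpen {U O : Set Plane} (hU : IsOpen U) (hne : U.Nonempty)
    (hO : O.Finite) : (U \ O).Nonempty := by
  by_contra h
  rw [not_nonempty_iff_eq_empty, sdiff_eq_empty] at h
  obtain ⟨x, hx⟩ := hne
  exact (infinite_of_mem_nhds x (hU.mem_nhds hx)) (hO.subset h)

/-- Two polygonal regions whose boundaries share no nondegenerate segment inside the open set `ω`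
meet there in finitely many points only. -/
theorem finite_inter_closure_of_not_hasInterface {ω P Q : Set Plane} (hω : IsOpen ω)
    (hP : IsPolygonalRegion P) (hQ : IsPolygonalRegion Q) (hd : Disjoint P Q)
    (hI : ¬ HasInterface ω P Q) : (ω ∩ closure P ∩ closure Q).Finite := by
  obtain ⟨m, a, b, hab⟩ := hP.frontier_eq
  obtain ⟨m', a', b', hab'⟩ := hQ.frontier_eq
  have hsub : ω ∩ closure P ∩ closure Q ⊆
      ⋃ k, ⋃ l, ω ∩ (segment ℝ (a k) (b k) ∩ segment ℝ (a' l) (b' l)) := by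
    rintro x ⟨⟨hxω, hxP⟩, hxQ⟩
    have h1 := frontier_of_mem_closure_inter hd hxP hxQ
    have h2 := frontier_of_mem_closure_inter hd.symm hxQ hxP
    rw [hab] at h1
    rw [hab'] at h2
    simp only [mem_iUnion] at h1 h2 ⊢
    obtain ⟨k, hk⟩ := h1
    obtain ⟨l, hl⟩ := h2
    exact ⟨k, l, hxω, hk, hl⟩
  refine (finite_iUnion fun k => finite_iUnion fun l => Set.Subsingleton.finite ?_).subset hsub
  rintro p ⟨hpω, hp⟩ q ⟨-, hq⟩
  by_contra hpq
  apply hI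
  have hcv : Convex ℝ (segment ℝ (a k) (b k) ∩ segment ℝ (a' l) (b' l)) :=
    (convex_segment _ _).inter (convex_segment _ _)
  -- a short piece of the common segment starting at `p` stays in `ω`
  obtain ⟨ε, hε, hεω⟩ := Metric.isOpen_iff.1 hω p hpω
  obtain ⟨s, hs0, hs1, hsε⟩ : ∃ s : ℝ, 0 < s ∧ s ≤ 1 ∧ s * ‖q - p‖ < ε := by
    have hn : 0 < ‖q - p‖ := norm_pos_iff.2 (sub_ne_zero.2 (Ne.symm hpq))
    refine ⟨min 1 (ε / (2 * ‖q - p‖)), by positivity, min_le_left _ _, ?_⟩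
    calc _ ≤ ε / (2 * ‖q - p‖) * ‖q - p‖ := by gcongr; exact min_le_right _ _
      _ = ε / 2 := by field_simp
      _ < ε := by linarith
  set z := p + s • (q - p)
  have hz : z ∈ segment ℝ (a k) (b k) ∩ segment ℝ (a' l) (b' l) :=
    hcv.add_smul_sub_mem hp hq ⟨hs0.le, hs1⟩
  refine ⟨p, z, fun h => ?_, fun w hw => ?_⟩
  · have : s • (q - p) = 0 := by simpa [z] using h
    rcases smul_eq_zero.1 this with h | h
    · exact hs0.ne' h
    · exact hpq (sub_eq_zero.1 h).symm
  · have hw1 := hcv.segment_subset hp hz hw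
    have hw2 : w ∈ ball p ε := by
      refine (convex_ball p ε).segment_subset (mem_ball_self hε) ?_ hw
      rw [mem_ball, dist_eq_norm]
      simpa [z, norm_smul, abs_of_pos hs0] using hsε
    refine ⟨⟨hεω hw2, frontier_subset_closure ?_⟩, frontier_subset_closure ?_⟩
    · rw [hab]; exact mem_iUnion.2 ⟨k, hw1.1⟩
    · rw [hab']; exact mem_iUnion.2 ⟨l, hw1.2⟩

/-- A connected open set that is tiled by at least two polygonal regions contains an interface,
because removing finitely many points does not disconnect a disc. -/
theorem exists_hasInterface {ω : Set Plane} (hω : IsOpen ω) (hc : IsConnected ω) {N : ℕ}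
    {cell : Fin N → Set Plane} (hN : 2 ≤ N) (hP : ∀ α, IsPolygonalRegion (cell α))
    (hd : ∀ α β, α ≠ β → Disjoint (cell α) (cell β)) (hsub : (⋃ α, cell α) ⊆ ω)
    (hnull : volume (ω \ ⋃ α, cell α) = 0) :
    ∃ α β, α ≠ β ∧ HasInterface ω (cell α) (cell β) := by
  by_contra! hno
  have hcov : ω ⊆ ⋃ α, closure (cell α) := by
    have hcl : IsClosed (⋃ α, closure (cell α)) :=
      isClosed_iUnion_of_finite fun _ => isClosed_closure
    have hz : volume (ω \ ⋃ α, closure (cell α)) = 0 :=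
      measure_mono_null (sdiff_subset_sdiff_right (iUnion_mono fun _ => subset_closure)) hnull
    rw [(hω.sdiff hcl).measure_eq_zero_iff volume, sdiff_eq_empty] at hz
    exact hz
  set O : Set Plane := ⋃ α, ⋃ β, ⋃ _ : α ≠ β, ω ∩ closure (cell α) ∩ closure (cell β)
  have hO : O.Finite := finite_iUnion fun α => finite_iUnion fun β => finite_iUnion fun h =>
    finite_inter_closure_of_not_hasInterface hω (hP α) (hP β) (hd α β h) (hno α β h)
  have hmeet : ∀ U : Set Plane, IsOpen U → ∀ α, ∀ x ∈ U, x ∈ closure (cell α) →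
      ((U \ O) ∩ closure (cell α)).Nonempty := by
    intro U hU α x hxU hx
    have hx' : x ∈ closure (interior (cell α)) :=
      closure_minimal (hP α).subset_closure_interior isClosed_closure hx
    obtain ⟨z, hz, hz'⟩ := diff_finite_nonempty_of_isOpen (hU.inter isOpen_interior)
      (mem_closure_iff.1 hx' U hU hxU) hO
    exact ⟨z, ⟨hz.1, hz'⟩, subset_closure (interior_subset hz.2)⟩
  let α₀ : Fin N := ⟨0, by omega⟩
  let β₀ : Fin N := ⟨1, by omega⟩
  have h01 : β₀ ≠ α₀ := by simp [α₀, β₀]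
  set C := closure (cell α₀)
  set D := ⋃ β, ⋃ _ : β ≠ α₀, closure (cell β) with hD
  have hDcl : IsClosed D := isClosed_iUnion_of_finite fun β => isClosed_iUnion_of_finite fun _ =>
    isClosed_closure
  have hCD : ω ⊆ C ∪ D := by
    intro x hx
    obtain ⟨β, hβ⟩ := mem_iUnion.1 (hcov hx)
    by_cases h : β = α₀
    · subst h; exact Or.inl hβ
    · exact Or.inr (mem_iUnion₂.2 ⟨β, h, hβ⟩)
  have hmem : ∀ α, (ω ∩ closure (cell α)).Nonempty := fun α => by
    obtain ⟨x, hx⟩ := (hP α).isConnected_interior.nonempty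
    exact ⟨x, hsub (mem_iUnion.2 ⟨α, interior_subset hx⟩), subset_closure (interior_subset hx)⟩
  have hne : (ω ∩ D).Nonempty := by
    obtain ⟨x, hx, hx'⟩ := hmem β₀
    exact ⟨x, hx, mem_iUnion₂.2 ⟨β₀, h01, hx'⟩⟩
  obtain ⟨x, hxω, hxC, hxD⟩ := isPreconnected_closed_iff.1 hc.isPreconnected C D isClosed_closure
    hDcl hCD (hmem α₀) hne
  obtain ⟨ρ, hρ, hρω⟩ := Metric.isOpen_iff.1 hω x hxω
  obtain ⟨β, hβ, hxβ⟩ := mem_iUnion₂.1 hxD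
  have hB := isPreconnected_ball_diff_countable x hρ hO.countable
  obtain ⟨z, hz⟩ := hmeet _ isOpen_ball β x (mem_ball_self hρ) hxβ
  obtain ⟨w, ⟨hwB, hwO⟩, hwC, hwD⟩ := isPreconnected_closed_iff.1 hB C D isClosed_closure hDcl
    (fun y hy => hCD (hρω hy.1)) (hmeet _ isOpen_ball α₀ x (mem_ball_self hρ) hxC)
    ⟨z, hz.1, mem_iUnion₂.2 ⟨β, hβ, hz.2⟩⟩
  obtain ⟨γ, hγ, hwγ⟩ := mem_iUnion₂.1 hwD
  exact hwO (mem_iUnion.2 ⟨α₀, mem_iUnion₂.2 ⟨γ, hγ.symm, ⟨hρω hwB, hwC⟩, hwγ⟩⟩)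

/-- A segment on which an affine function vanishes at two distinct points lies in its zero set. -/
theorem segment_subset_of_affine_eq_zero (ψ : Plane →L[ℝ] ℝ) (t : ℝ) {c d p q : Plane}
    (hp : p ∈ segment ℝ c d) (hq : q ∈ segment ℝ c d) (hpq : p ≠ q) (hpt : ψ p = t)
    (hqt : ψ q = t) : segment ℝ c d ⊆ {x | ψ x = t} := by
  rw [segment_eq_image'] at hp hq ⊢
  obtain ⟨s, -, rfl⟩ := hp
  obtain ⟨s', -, rfl⟩ := hq
  have hs : s - s' ≠ 0 := fun h => hpq (by rw [sub_eq_zero.1 h])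
  simp only [map_add, map_smul, smul_eq_mul] at hpt hqt
  have h0 : ψ (d - c) = 0 := by
    have : (s - s') * ψ (d - c) = 0 := by linarith
    exact (mul_eq_zero.1 this).resolve_left hs
  rintro x ⟨θ, -, rfl⟩
  simp only [mem_ofPred_eq, map_add, map_smul, h0, smul_zero] at hpt ⊢
  simpa [h0] using hpt

/-- Near a point `x` that avoids the finitely many transversal crossings of boundary segments with
the line `{ψ = ψ x}`, the boundary of a polygonal region lies in that line. -/
theorem exists_ball_inter_frontier_subset {P : Set Plane} (hP : IsPolygonalRegion P)
    (ψ : Plane →L[ℝ] ℝ) (t : ℝ) : ∃ F : Set Plane, F.Finite ∧ ∀ x, ψ x = t → x ∉ F →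
      ∃ ρ > 0, ball x ρ ∩ frontier P ⊆ {y | ψ y = t} := by
  obtain ⟨m, a, b, hab⟩ := hP.frontier_eq
  set K : Set (Fin m) := {k | ¬ segment ℝ (a k) (b k) ⊆ {y | ψ y = t}}
  refine ⟨⋃ k ∈ K, segment ℝ (a k) (b k) ∩ {y | ψ y = t}, ?_, fun x hx hxF => ?_⟩
  · refine (toFinite K).biUnion fun k hk => Set.Subsingleton.finite ?_
    rintro p ⟨hp, hpt⟩ q ⟨hq, hqt⟩
    by_contra hpq
    exact hk (segment_subset_of_affine_eq_zero ψ t hp hq hpq hpt hqt)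
  · have hcl : IsClosed (⋃ k ∈ K, segment ℝ (a k) (b k)) := by
      refine (toFinite K).isClosed_biUnion fun k _ => ?_
      rw [segment_eq_image']
      exact (isCompact_Icc.image (by fun_prop)).isClosed
    have hx' : x ∈ (⋃ k ∈ K, segment ℝ (a k) (b k))ᶜ := by
      intro h
      simp only [mem_iUnion] at h hxF
      obtain ⟨k, hk, h⟩ := h
      exact hxF ⟨k, hk, h, hx⟩
    obtain ⟨ρ, hρ, hsub⟩ := Metric.isOpen_iff.1 hcl.isOpen_compl x hx'
    refine ⟨ρ, hρ, ?_⟩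
    rintro y ⟨hy, hyP⟩
    rw [hab] at hyP
    obtain ⟨k, hk⟩ := mem_iUnion.1 hyP
    by_cases hkK : k ∈ K
    · exact absurd (mem_iUnion₂.2 ⟨k, hkK, hk⟩) (hsub hy)
    · exact (not_not.1 hkK) hk

/-- If the boundary of a set in a disc is contained in a line through the centre, then the set
contains one of the two open half discs. -/
theorem half_ball_subset {P : Set Plane} {ψ : Plane →L[ℝ] ℝ} {e : Plane} (he : ψ e = 1)
    {x : Plane} {ρ : ℝ} (hρ : 0 < ρ) (hx : x ∈ closure (interior P))
    (hF : ball x ρ ∩ frontier P ⊆ {y | ψ y = ψ x}) :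
    (∀ y ∈ ball x ρ, ψ x < ψ y → y ∈ P) ∨ (∀ y ∈ ball x ρ, ψ y < ψ x → y ∈ P) := by
  have key : ∀ H : Set Plane, Convex ℝ H → (∀ y ∈ H, ψ y ≠ ψ x) →
      (ball x ρ ∩ H ∩ interior P).Nonempty → ball x ρ ∩ H ⊆ P := by
    intro H hH hHne hne y hy
    by_contra hyP
    have hcov : ball x ρ ∩ H ⊆ interior P ∪ (closure P)ᶜ := by
      intro w hw
      by_contra hw'
      rw [mem_union, not_or, mem_compl_iff, not_not] at hw'
      exact hHne w hw.2 (hF ⟨hw.1, hw'.2, hw'.1⟩)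
    obtain ⟨w, -, hw, hw'⟩ := ((convex_ball x ρ).inter hH).isPreconnected _ _ isOpen_interior
      isClosed_closure.isOpen_compl hcov hne
      ⟨y, hy, (hcov hy).resolve_left fun h => hyP (interior_subset h)⟩
    exact hw' (subset_closure (interior_subset hw))
  obtain ⟨z, hzb, hzP⟩ := mem_closure_iff.1 hx _ isOpen_ball (mem_ball_self hρ)
  obtain ⟨z', hz', hne⟩ : ∃ z' ∈ ball x ρ ∩ interior P, ψ z' ≠ ψ x := by
    by_cases h : ψ z = ψ x
    · have hopen : IsOpen (ball x ρ ∩ interior P) := isOpen_ball.inter isOpen_interior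
      have hcont : Continuous fun s : ℝ => z + s • e := by fun_prop
      have hev : ∀ᶠ s in 𝓝 (0 : ℝ), z + s • e ∈ ball x ρ ∩ interior P :=
        hcont.continuousAt.eventually_mem (hopen.mem_nhds (by simpa using ⟨hzb, hzP⟩))
      obtain ⟨s, hs, hs0⟩ := ((hev.filter_mono nhdsWithin_le_nhds).and
        (self_mem_nhdsWithin (s := ({0}ᶜ : Set ℝ)))).exists
      exact ⟨_, hs, by simpa [he, h] using hs0⟩
    · exact ⟨z, ⟨hzb, hzP⟩, h⟩
  have hlin : IsLinearMap ℝ ψ := ψ.toLinearMap.isLinear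
  rcases lt_or_gt_of_ne hne with h | h
  · refine Or.inr fun y hy hy' => key {y | ψ y < ψ x} (convex_halfSpace_lt hlin _)
      (fun y hy => ne_of_lt hy) ⟨z', ⟨hz'.1, h⟩, hz'.2⟩ ⟨hy, hy'⟩
  · refine Or.inl fun y hy hy' => key {y | ψ x < ψ y} (convex_halfSpace_gt hlin _)
      (fun y hy => ne_of_gt hy) ⟨z', ⟨hz'.1, h⟩, hz'.2⟩ ⟨hy, hy'⟩

/-- Every direction `v` of the plane is annihilated by a linear functional that takes the value `1`
on one of the two coordinate vectors. -/
theorem exists_functional_eq_zero (v : Plane) : ∃ (j : Fin 2) (ψ : Plane →L[ℝ] ℝ),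
    ψ (EuclideanSpace.single j 1) = 1 ∧ ψ v = 0 := by
  by_cases h : v 0 = 0
  · exact ⟨0, EuclideanSpace.proj 0, by simp, by simpa using h⟩
  · refine ⟨1, EuclideanSpace.proj 1 - (v 1 / v 0) • EuclideanSpace.proj 0, by simp, ?_⟩
    simp [h]

/-- In a nonisometric origami design there is a disc, cut by a line transversal to a coordinate
direction, such that the director is constant on either half disc, with planar parts that are
neither equal nor opposite. -/
theorem IsNonisometricOrigamiDesign.exists_half_balls {ω : Set Plane} {n₀ : Plane → Space}
    (h : IsNonisometricOrigamiDesign ω n₀) :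
    ∃ (x₀ : Plane) (ρ : ℝ) (j : Fin 2) (ψ : Plane →L[ℝ] ℝ) (n n' : Space),
      0 < ρ ∧ ball x₀ ρ ⊆ ω ∧ ψ (EuclideanSpace.single j 1) = 1 ∧
      planarPart n ≠ planarPart n' ∧ planarPart n ≠ -planarPart n' ∧
      (∀ y ∈ ball x₀ ρ, ψ x₀ < ψ y → n₀ y = n) ∧ (∀ y ∈ ball x₀ ρ, ψ y < ψ x₀ → n₀ y = n') := by
  obtain ⟨N, cell, n, hN, hP, hd, hsub, hnull, hn, hjump⟩ := h.exists_cells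
  obtain ⟨α, β, hαβ, hI⟩ := exists_hasInterface h.isOpen h.isConnected hN hP hd hsub hnull
  obtain ⟨hne, hne'⟩ := hjump α β hαβ hI
  obtain ⟨a, b, hab, hseg⟩ := hI
  obtain ⟨j, ψ, hj, hψ⟩ := exists_functional_eq_zero (b - a)
  obtain ⟨F, hF, hFα⟩ := exists_ball_inter_frontier_subset (hP α) ψ (ψ a)
  obtain ⟨F', hF', hFβ⟩ := exists_ball_inter_frontier_subset (hP β) ψ (ψ a)
  have hinf : (segment ℝ a b).Infinite := by
    rw [segment_eq_image']
    refine (Icc_infinite (zero_lt_one' ℝ)).image fun s _ t _ hst => ?_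
    have : (s - t) • (b - a) = 0 := by
      rw [sub_smul, sub_eq_zero]; exact add_left_cancel hst
    rcases smul_eq_zero.1 this with h | h
    · exact sub_eq_zero.1 h
    · exact absurd (sub_eq_zero.1 h).symm hab
  obtain ⟨x, hx, hxF⟩ := (hinf.sdiff (hF.union hF')).nonempty
  rw [mem_union, not_or] at hxF
  obtain ⟨⟨hxω, hxα⟩, hxβ⟩ := hseg hx
  have hxa : ψ x = ψ a := by
    rw [segment_eq_image'] at hx
    obtain ⟨θ, -, rfl⟩ := hx
    simp only [map_add, map_smul, hψ, smul_zero, add_zero]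
  obtain ⟨ρ₁, hρ₁, h₁⟩ := Metric.isOpen_iff.1 h.isOpen x hxω
  obtain ⟨ρ₂, hρ₂, h₂⟩ := hFα x hxa hxF.1
  obtain ⟨ρ₃, hρ₃, h₃⟩ := hFβ x hxa hxF.2
  set ρ := min ρ₁ (min ρ₂ ρ₃)
  have hρ : 0 < ρ := lt_min hρ₁ (lt_min hρ₂ hρ₃)
  have hle₂ : ball x ρ ⊆ ball x ρ₂ := ball_subset_ball ((min_le_right _ _).trans (min_le_left _ _))
  have hle₃ : ball x ρ ⊆ ball x ρ₃ := ball_subset_ball ((min_le_right _ _).trans (min_le_right _ _))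
  rw [← hxa] at h₂ h₃
  have hα := half_ball_subset hj hρ
    (closure_minimal (hP α).subset_closure_interior isClosed_closure hxα)
    ((inter_subset_inter_left _ hle₂).trans h₂)
  have hβ := half_ball_subset hj hρ
    (closure_minimal (hP β).subset_closure_interior isClosed_closure hxβ)
    ((inter_subset_inter_left _ hle₃).trans h₃)
  -- both half discs are nonempty, so two disjoint regions cannot contain the same one
  have hpt : ∀ s : ℝ, |s| < ρ → x + s • EuclideanSpace.single j (1 : ℝ) ∈ ball x ρ := fun s hs => by
    simpa [norm_smul] using hs
  have hpos := hpt (ρ / 2) (by rw [abs_of_pos (by positivity)]; linarith)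
  have hneg := hpt (-(ρ / 2)) (by rw [abs_neg, abs_of_pos (by positivity)]; linarith)
  have hωρ : ball x ρ ⊆ ω := (ball_subset_ball (min_le_left _ _)).trans h₁
  rcases hα with hα | hα <;> rcases hβ with hβ | hβ
  · have hs : ψ x < ψ (x + (ρ / 2) • EuclideanSpace.single j (1 : ℝ)) := by
      simp only [map_add, map_smul, hj, smul_eq_mul]; linarith
    exact absurd rfl ((hd α β hαβ).ne_of_mem (hα _ hpos hs) (hβ _ hpos hs))
  · exact ⟨x, ρ, j, ψ, n α, n β, hρ, hωρ, hj, hne, hne', fun y hy hy' => hn α y (hα y hy hy'),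
      fun y hy hy' => hn β y (hβ y hy hy')⟩
  · refine ⟨x, ρ, j, ψ, n β, n α, hρ, hωρ, hj, hne.symm, fun h => hne' ?_,
      fun y hy hy' => hn β y (hβ y hy hy'), fun y hy hy' => hn α y (hα y hy hy')⟩
    rw [h, neg_neg]
  · have hs : ψ (x + (-(ρ / 2)) • EuclideanSpace.single j (1 : ℝ)) < ψ x := by
      simp only [map_add, map_smul, hj, smul_eq_mul]; linarith
    exact absurd rfl ((hd α β hαβ).ne_of_mem (hα _ hneg hs) (hβ _ hneg hs))

/-! ### The one-dimensional transition estimate and the energy wells -/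

/-- The Modica–Mortola bound on an interval. Suppose that leaving `{2 m ≤ V}` for `{V ≤ m}` costs at
least the distance `η`. A curve that meets `{2 m ≤ V}` either stays in `{m < V}`, which costs
`m (b - a)`, or makes a transition, during which `V + h² |u'|² ≥ 2 h √m |u'|`. -/
theorem le_lintegral_of_transition {E : Type*} [NormedAddCommGroup E] [NormedSpace ℝ E]
    [CompleteSpace E] {V : E → ℝ} (hV : Continuous V) {m η h : ℝ} (hm : 0 < m)
    (hh : 0 < h) (htrans : ∀ x y, 2 * m ≤ V x → V y ≤ m → η ≤ dist x y) {u u' : ℝ → E}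
    (hu : ∀ t, HasDerivAt u (u' t) t) (hu' : Continuous u') {a b c : ℝ}
    (hc : c ∈ Icc a b) (hVc : 2 * m ≤ V (u c)) :
    ENNReal.ofReal (min (m * (b - a)) (2 * h * √m * η)) ≤
      ∫⁻ t in Ioo a b, ENNReal.ofReal (V (u t) + h ^ 2 * ‖u' t‖ ^ 2) := by
  have hucont : Continuous u := continuous_iff_continuousAt.2 fun t => (hu t).continuousAt
  have hVu : Continuous fun t => V (u t) := hV.comp hucont
  rw [setLIntegral_congr (Ioo_ae_eq_Icc (a := a) (b := b))]
  by_cases hK : ∃ d ∈ Icc a b, V (u d) ≤ m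
  · -- the point of `{V ≤ m}` that is closest to `c`
    have hcpt : IsCompact (Icc a b ∩ {t | V (u t) ≤ m}) :=
      isCompact_Icc.inter_right (isClosed_le hVu continuous_const)
    obtain ⟨d, ⟨hd, hVd⟩, hmin⟩ := hcpt.exists_isMinOn (f := fun t => |t - c|)
      (by obtain ⟨d, hd, hVd⟩ := hK; exact ⟨d, hd, hVd⟩) (by fun_prop)
    have hlow : ∀ t ∈ Ι c d, t ≠ d → m ≤ V (u t) := by
      intro t ht htd
      by_contra! hlt
      have htab : t ∈ Icc a b := by
        have : t ∈ uIcc c d := uIoc_subset_uIcc ht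
        exact (uIcc_subset_Icc hc hd) this
      have h1 : |d - c| ≤ |t - c| := hmin ⟨htab, hlt.le⟩
      rcases le_total c d with hcd | hcd
      · rw [uIoc_of_le hcd] at ht
        rw [abs_of_nonneg (by linarith), abs_of_nonneg (by linarith [ht.1])] at h1
        exact htd (le_antisymm ht.2 (by linarith))
      · rw [uIoc_of_ge hcd] at ht
        rw [abs_of_nonpos (by linarith), abs_of_nonpos (by linarith [ht.2])] at h1
        linarith [ht.1]
    have hη : ENNReal.ofReal η ≤ ∫⁻ t in Ι c d, ‖u' t‖ₑ := by
      have hint : ∫ t in c..d, u' t = u d - u c :=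
        intervalIntegral.integral_eq_sub_of_hasDerivAt (fun t _ => hu t)
          (hu'.intervalIntegrable _ _)
      calc ENNReal.ofReal η ≤ ENNReal.ofReal ‖u d - u c‖ := by
            apply ENNReal.ofReal_le_ofReal
            rw [← dist_eq_norm, dist_comm]
            exact htrans _ _ hVc hVd
        _ = ‖∫ t in Ι c d, u' t‖ₑ := by
            rw [← hint, intervalIntegral.norm_intervalIntegral_eq, ofReal_norm]
        _ ≤ _ := enorm_integral_le_lintegral_enorm _
    calc ENNReal.ofReal (min (m * (b - a)) (2 * h * √m * η))
        ≤ ENNReal.ofReal (2 * h * √m * η) := ENNReal.ofReal_le_ofReal (min_le_right _ _)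
      _ = ENNReal.ofReal (2 * h * √m) * ENNReal.ofReal η := ENNReal.ofReal_mul (by positivity)
      _ ≤ ENNReal.ofReal (2 * h * √m) * ∫⁻ t in Ι c d, ‖u' t‖ₑ := by gcongr
      _ = ∫⁻ t in Ι c d, ENNReal.ofReal (2 * h * √m) * ‖u' t‖ₑ :=
          (lintegral_const_mul' _ _ ENNReal.ofReal_ne_top).symm
      _ ≤ ∫⁻ t in Ι c d, ENNReal.ofReal (V (u t) + h ^ 2 * ‖u' t‖ ^ 2) := by
          refine lintegral_mono_ae ?_
          filter_upwards [ae_restrict_mem measurableSet_uIoc,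
            ae_restrict_of_ae (Measure.ae_ne volume d)] with t ht htd
          rw [← ofReal_norm, ← ENNReal.ofReal_mul (by positivity)]
          apply ENNReal.ofReal_le_ofReal
          have := hlow t ht htd
          nlinarith [sq_nonneg (√m - h * ‖u' t‖), Real.sq_sqrt hm.le]
      _ ≤ _ := lintegral_mono_set (uIoc_subset_uIcc.trans (uIcc_subset_Icc hc hd))
  · push Not at hK
    calc ENNReal.ofReal (min (m * (b - a)) (2 * h * √m * η))
        ≤ ENNReal.ofReal (m * (b - a)) := ENNReal.ofReal_le_ofReal (min_le_left _ _)
      _ = ∫⁻ t in Icc a b, ENNReal.ofReal m := by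
          rw [setLIntegral_const, Real.volume_Icc, ENNReal.ofReal_mul hm.le]
      _ ≤ _ := by
          refine setLIntegral_mono' measurableSet_Icc fun t ht => ?_
          apply ENNReal.ofReal_le_ofReal
          have := hK t ht
          nlinarith [sq_nonneg (h * ‖u' t‖)]

/-- The deviation `|FᵀF - A|²` of the metric of a gradient `F`, given by its two columns, from `A`. -/
def metricDefect (A : Matrix (Fin 2) (Fin 2) ℝ) (F : Fin 2 → Space) : ℝ :=
  frobeniusSq ((Matrix.of fun k i => F i k : Matrix (Fin 3) (Fin 2) ℝ).transpose *
    (Matrix.of fun k i => F i k : Matrix (Fin 3) (Fin 2) ℝ) - A)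

theorem frobeniusSq_nonneg {m n : Type*} [Fintype m] [Fintype n] (A : Matrix m n ℝ) :
    0 ≤ frobeniusSq A :=
  Finset.sum_nonneg fun _ _ => Finset.sum_nonneg fun _ _ => sq_nonneg _

theorem metricDefect_nonneg (A : Matrix (Fin 2) (Fin 2) ℝ) (F : Fin 2 → Space) :
    0 ≤ metricDefect A F := frobeniusSq_nonneg _

theorem continuous_metricDefect (A : Matrix (Fin 2) (Fin 2) ℝ) : Continuous (metricDefect A) := by
  unfold metricDefect frobeniusSq
  simp only [Matrix.sub_apply, Matrix.mul_apply, Matrix.transpose_apply, Matrix.of_apply]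
  fun_prop

theorem isCompact_metricDefect_le (A : Matrix (Fin 2) (Fin 2) ℝ) (m : ℝ) :
    IsCompact {F | metricDefect A F ≤ m} := by
  refine Metric.isCompact_of_isClosed_isBounded
    (isClosed_le (continuous_metricDefect A) continuous_const) ?_
  refine (Metric.isBounded_iff_subset_closedBall 0).2
    ⟨∑ i, (1 + |A i i| + √m), fun F hF => ?_⟩
  have hpos : ∀ i, 0 ≤ 1 + |A i i| + √m := fun i => by positivity
  rw [mem_closedBall_zero_iff, pi_norm_le_iff_of_nonneg (Finset.sum_nonneg fun i _ => hpos i)]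
  intro i
  refine le_trans ?_ (Finset.single_le_sum (f := fun i => 1 + |A i i| + √m)
    (fun i _ => hpos i) (Finset.mem_univ i))
  have hdiag : (‖F i‖ ^ 2 - A i i) ^ 2 ≤ m := by
    refine le_trans ?_ hF
    have h1 : ‖F i‖ ^ 2 - A i i = ((Matrix.of fun k i => F i k : Matrix (Fin 3) (Fin 2) ℝ).transpose *
        (Matrix.of fun k i => F i k : Matrix (Fin 3) (Fin 2) ℝ) - A) i i := by
      rw [EuclideanSpace.real_norm_sq_eq]
      simp [Matrix.mul_apply, sq]
    rw [h1]
    refine le_trans ?_ (Finset.single_le_sum (fun _ _ => Finset.sum_nonneg fun _ _ => sq_nonneg _)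
      (Finset.mem_univ i))
    exact Finset.single_le_sum (f := fun j => (((Matrix.of fun k i => F i k :
      Matrix (Fin 3) (Fin 2) ℝ).transpose * (Matrix.of fun k i => F i k :
      Matrix (Fin 3) (Fin 2) ℝ) - A) i j) ^ 2) (fun _ _ => sq_nonneg _) (Finset.mem_univ i)
  have h2 := Real.abs_le_sqrt hdiag
  have h3 := (abs_le.1 h2).2
  have h4 := le_abs_self (A i i)
  nlinarith [sq_nonneg (‖F i‖ - 1), sq_nonneg (‖F i‖)]

/-- Leaving `{2 m ≤ metricDefect A}` for `{metricDefect A ≤ m}` costs a positive distance, because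
the latter set is compact. -/
theorem exists_transition_cost (A : Matrix (Fin 2) (Fin 2) ℝ) {m : ℝ} (hm : 0 < m) :
    ∃ η > 0, ∀ F G, 2 * m ≤ metricDefect A F → metricDefect A G ≤ m → η ≤ dist F G := by
  obtain ⟨η, hη, hsub⟩ := (isCompact_metricDefect_le A m).exists_thickening_subset_open
    (isOpen_lt (continuous_metricDefect A) (continuous_const (y := 2 * m)))
    (fun F (hF : _ ≤ m) => show _ < 2 * m by linarith)
  refine ⟨η, hη, fun F G hF hG => ?_⟩
  by_contra! hlt
  exact absurd (hsub (mem_thickening_iff.2 ⟨G, hG, hlt⟩)) (not_lt.2 hF)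

theorem frobeniusSq_sub_le {m n : Type*} [Fintype m] [Fintype n] (A B C : Matrix m n ℝ) :
    frobeniusSq (A - B) ≤ 2 * frobeniusSq (C - A) + 2 * frobeniusSq (C - B) := by
  unfold frobeniusSq
  simp only [Finset.mul_sum, ← Finset.sum_add_distrib]
  refine Finset.sum_le_sum fun i _ => Finset.sum_le_sum fun j _ => ?_
  simp only [Matrix.sub_apply]
  nlinarith [sq_nonneg (C i j - A i j + (C i j - B i j))]

theorem frobeniusSq_pos {m n : Type*} [Fintype m] [Fintype n] {A : Matrix m n ℝ} (hA : A ≠ 0) :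
    0 < frobeniusSq A := by
  refine lt_of_le_of_ne (frobeniusSq_nonneg A) fun h => hA ?_
  ext i j
  have h1 := (Finset.sum_eq_zero_iff_of_nonneg fun i _ => Finset.sum_nonneg fun j _ =>
    sq_nonneg (A i j)).1 h.symm i (Finset.mem_univ i)
  have h2 := (Finset.sum_eq_zero_iff_of_nonneg fun j _ => sq_nonneg (A i j)).1 h1 j
    (Finset.mem_univ j)
  simpa using h2

/-- The metric determines `ñ ⊗ ñ`, hence `ñ` up to sign. -/
theorem midplaneMetric_ne {r : ℝ} (hr : 0 < r) (hr1 : r ≠ 1) {n n' : Space}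
    (h : planarPart n ≠ planarPart n') (h' : planarPart n ≠ -planarPart n') :
    midplaneMetric r n ≠ midplaneMetric r n' := by
  intro heq
  have hc : r ^ (-(1 / 3 : ℝ)) ≠ 0 := (Real.rpow_pos_of_pos hr _).ne'
  have hr1' : r - 1 ≠ 0 := sub_ne_zero.2 hr1
  have key : ∀ i j, planarPart n i * planarPart n j = planarPart n' i * planarPart n' j := by
    intro i j
    have := congrFun (congrFun heq i) j
    simp only [midplaneMetric, Matrix.smul_apply, Matrix.add_apply, Matrix.vecMulVec_apply,
      smul_eq_mul] at this
    exact mul_left_cancel₀ hr1' (add_left_cancel (mul_left_cancel₀ hc this))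
  have h00 := key 0 0
  have h01 := key 0 1
  have h11 := key 1 1
  rcases mul_self_eq_mul_self_iff.1 h00 with h0 | h0 <;>
    rcases mul_self_eq_mul_self_iff.1 h11 with h1 | h1
  · exact h (by ext i; fin_cases i <;> assumption)
  · rw [h0, h1] at h01
    have h2 : planarPart n' 0 * planarPart n' 1 = 0 := by linarith
    rcases mul_eq_zero.1 h2 with h2 | h2
    · exact h' (by ext i; fin_cases i <;> simp [h0, h1, h2])
    · exact h (by ext i; fin_cases i <;> simp [h0, h1, h2])
  · rw [h0, h1] at h01
    have h2 : planarPart n' 0 * planarPart n' 1 = 0 := by linarith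
    rcases mul_eq_zero.1 h2 with h2 | h2
    · exact h (by ext i; fin_cases i <;> simp [h0, h1, h2])
    · exact h' (by ext i; fin_cases i <;> simp [h0, h1, h2])
  · exact h' (by ext i; fin_cases i <;> assumption)

/-! ### Mollification of Sobolev maps -/

/-- The mollification of `f`, extended by zero outside `ω`, with the bump function `φ`. -/
def mollify (ω : Set Plane) (φ : ContDiffBump (0 : Plane)) (f : Plane → Space) : Plane → Space :=
  φ.normed volume ⋆[lsmul ℝ ℝ, volume] ω.indicator f

theorem locallyIntegrable_indicator {ω : Set Plane} (hω : IsOpen ω) {f : Plane → Space}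
    (hf : MemLp f 2 (volume.restrict ω)) : LocallyIntegrable (ω.indicator f) volume :=
  ((memLp_indicator_iff_restrict hω.measurableSet).2 hf).locallyIntegrable (by norm_num)

theorem contDiff_mollify {ω : Set Plane} (hω : IsOpen ω) (φ : ContDiffBump (0 : Plane))
    {f : Plane → Space} (hf : MemLp f 2 (volume.restrict ω)) : ContDiff ℝ 1 (mollify ω φ f) :=
  φ.hasCompactSupport_normed.contDiff_convolution_left _ φ.contDiff_normed
    (locallyIntegrable_indicator hω hf)

/-- Mollification commutes with weak derivatives at points whose distance to the complement of the
domain exceeds the radius of the mollifier. -/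
theorem fderiv_mollify {ω : Set Plane} (hω : IsOpen ω) {f g : Plane → Space} {j : Fin 2}
    (hf : MemLp f 2 (volume.restrict ω)) (hw : IsWeakPartial ω j f g)
    (φ : ContDiffBump (0 : Plane)) {x : Plane} (hx : closedBall x φ.rOut ⊆ ω) :
    fderiv ℝ (mollify ω φ f) x (EuclideanSpace.single j 1) = mollify ω φ g x := by
  have hfl := locallyIntegrable_indicator hω hf
  have hφs : HasCompactSupport (φ.normed volume) := φ.hasCompactSupport_normed
  have hφd : ContDiff ℝ ((⊤ : ℕ∞) : WithTop ℕ∞) (φ.normed volume) := φ.contDiff_normed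
  have hφd1 : ContDiff ℝ 1 (φ.normed volume) := φ.contDiff_normed
  set ψ : Plane → ℝ := fun z => φ.normed volume (x - z) with hψ
  have hψd : ContDiff ℝ ((⊤ : ℕ∞) : WithTop ℕ∞) ψ := hφd.comp (by fun_prop)
  have hψs : tsupport ψ ⊆ closedBall x φ.rOut := by
    refine closure_minimal (fun z hz => ?_) isClosed_closedBall
    have : x - z ∈ Function.support (φ.normed volume) := hz
    rw [φ.support_normed_eq, mem_ball_zero_iff, ← dist_eq_norm, dist_comm] at this
    exact this.le
  have hψc : HasCompactSupport ψ :=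
    (isCompact_closedBall x φ.rOut).of_isClosed_subset (isClosed_tsupport _) hψs
  have hψ' : ∀ z v, fderiv ℝ ψ z v = -fderiv ℝ (φ.normed volume) (x - z) v := by
    intro z v
    have h1 : HasFDerivAt (φ.normed volume) (fderiv ℝ (φ.normed volume) (x - z)) (x - z) :=
      ((hφd1.differentiable one_ne_zero) _).hasFDerivAt
    have h2 : HasFDerivAt (fun z : Plane => x - z) (-ContinuousLinearMap.id ℝ Plane) z :=
      (hasFDerivAt_id z).const_sub x
    have h3 : HasFDerivAt ψ _ z := h1.comp z h2
    rw [h3.fderiv]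
    simp
  have hd := hφs.hasFDerivAt_convolution_left (lsmul ℝ ℝ : ℝ →L[ℝ] Space →L[ℝ] Space)
    (μ := volume) hφd1 hfl x
  have hint : Integrable (fun t => ((lsmul ℝ ℝ : ℝ →L[ℝ] Space →L[ℝ] Space).precompL Plane)
      (fderiv ℝ (φ.normed volume) (x - t)) (ω.indicator f t)) volume := by
    have := (hφs.fderiv ℝ).convolutionExists_left (μ := volume)
      ((lsmul ℝ ℝ : ℝ →L[ℝ] Space →L[ℝ] Space).precompL Plane)
      (hφd1.continuous_fderiv one_ne_zero) hfl x
    exact this.integrable_swap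
  have hleft : fderiv ℝ (mollify ω φ f) x (EuclideanSpace.single j 1) =
      ∫ t in ω, fderiv ℝ (φ.normed volume) (x - t) (EuclideanSpace.single j 1) • f t := by
    unfold mollify
    rw [hd.fderiv, convolution_eq_swap, ContinuousLinearMap.integral_apply hint,
      ← integral_indicator hω.measurableSet]
    refine integral_congr_ae (Filter.Eventually.of_forall fun t => ?_)
    by_cases ht : t ∈ ω <;> simp [ht]
  have hright : mollify ω φ g x = ∫ t in ω, ψ t • g t := by
    unfold mollify
    rw [convolution_eq_swap, ← integral_indicator hω.measurableSet]
    refine integral_congr_ae (Filter.Eventually.of_forall fun t => ?_)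
    by_cases ht : t ∈ ω <;> simp [ht, hψ]
  have := hw ψ hψd hψc (hψs.trans hx)
  rw [hleft, hright, ← neg_inj, ← this, ← integral_neg]
  simp only [hψ', neg_smul]

theorem lintegral_normed_bump (φ : ContDiffBump (0 : Plane)) :
    ∫⁻ t, ENNReal.ofReal (φ.normed volume t) = 1 := by
  rw [← ofReal_integral_eq_lintegral_ofReal φ.integrable_normed
    (Filter.Eventually.of_forall fun t => φ.nonneg_normed t), φ.integral_normed, ENNReal.ofReal_one]

/-- Mollification does not increase the `L²` norm. -/
theorem lintegral_mollify_sq_le {ω : Set Plane} (hω : IsOpen ω) {g : Plane → Space}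
    (hg : MemLp g 2 (volume.restrict ω)) (φ : ContDiffBump (0 : Plane)) :
    ∫⁻ x, ‖mollify ω φ g x‖ₑ ^ 2 ≤ ∫⁻ x in ω, ‖g x‖ₑ ^ 2 := by
  set G := ω.indicator g with hG
  have hGm : AEStronglyMeasurable G volume :=
    ((memLp_indicator_iff_restrict hω.measurableSet).2 hg).1
  set w : Plane → ℝ≥0∞ := fun t => ENNReal.ofReal (φ.normed volume t) with hw
  have hwm : Measurable w := φ.continuous_normed.measurable.ennreal_ofReal
  have hw1 : ∫⁻ t, w t = 1 := lintegral_normed_bump φ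
  have hGx : ∀ x, AEMeasurable (fun t => ‖G (x - t)‖ₑ) volume := fun x =>
    (hGm.enorm).comp_quasiMeasurePreserving
      (quasiMeasurePreserving_sub_left volume x)
  have hpt : ∀ x, ‖mollify ω φ g x‖ₑ ^ 2 ≤ ∫⁻ t, w t * ‖G (x - t)‖ₑ ^ 2 := by
    intro x
    have h1 : ‖mollify ω φ g x‖ₑ ≤ ∫⁻ t, w t * ‖G (x - t)‖ₑ := by
      refine (enorm_integral_le_lintegral_enorm _).trans (lintegral_mono fun t => ?_)
      simp only [ContinuousLinearMap.lsmul_apply, enorm_smul]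
      rw [Real.enorm_of_nonneg (φ.nonneg_normed t)]
    have : IsProbabilityMeasure (volume.withDensity w) :=
      ⟨by rw [withDensity_apply _ MeasurableSet.univ, Measure.restrict_univ, hw1]⟩
    have habs : volume.withDensity w ≪ (volume : Measure Plane) := withDensity_absolutelyContinuous _ _
    have h2 := ENNReal.lintegral_mul_le_Lp_mul_Lq (volume.withDensity w) Real.HolderConjugate.two_two
      (f := fun t => ‖G (x - t)‖ₑ) (g := fun _ => 1) ((hGx x).mono_ac habs) aemeasurable_const
    simp only [Pi.mul_apply, mul_one, lintegral_const, measure_univ, ENNReal.rpow_two,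
      one_pow, ENNReal.one_rpow] at h2
    rw [lintegral_withDensity_eq_lintegral_mul_non_measurable₀ _ hwm.aemeasurable
      (Filter.Eventually.of_forall fun t => ENNReal.ofReal_lt_top),
      lintegral_withDensity_eq_lintegral_mul_non_measurable₀ _ hwm.aemeasurable
      (Filter.Eventually.of_forall fun t => ENNReal.ofReal_lt_top)] at h2
    calc ‖mollify ω φ g x‖ₑ ^ 2 ≤ (∫⁻ t, w t * ‖G (x - t)‖ₑ) ^ 2 := by gcongr
      _ ≤ ((∫⁻ t, w t * ‖G (x - t)‖ₑ ^ 2) ^ (1 / 2 : ℝ)) ^ 2 := by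
          gcongr
          exact h2
      _ = _ := by
          rw [← ENNReal.rpow_natCast, ← ENNReal.rpow_mul]
          norm_num
  calc ∫⁻ x, ‖mollify ω φ g x‖ₑ ^ 2 ≤ ∫⁻ x, ∫⁻ t, w t * ‖G (x - t)‖ₑ ^ 2 := lintegral_mono hpt
    _ = ∫⁻ t, ∫⁻ x, w t * ‖G (x - t)‖ₑ ^ 2 := by
        refine lintegral_lintegral_swap ?_
        have h1 : AEMeasurable (fun p : Plane × Plane => ‖G (p.1 - p.2)‖ₑ) (volume.prod volume) :=
          hGm.enorm.comp_quasiMeasurePreserving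
            (quasiMeasurePreserving_sub_of_right_invariant volume volume)
        exact (hwm.comp measurable_snd).aemeasurable.mul (h1.pow_const 2)
    _ = ∫⁻ t, w t * ∫⁻ x, ‖G x‖ₑ ^ 2 := by
        refine lintegral_congr fun t => ?_
        rw [lintegral_const_mul' _ _ ENNReal.ofReal_ne_top,
          lintegral_sub_right_eq_self (fun x => ‖G x‖ₑ ^ 2) t]
    _ = ∫⁻ x, ‖G x‖ₑ ^ 2 := by
        rw [lintegral_mul_const _ hwm, hw1, one_mul]
    _ = ∫⁻ x in ω, ‖g x‖ₑ ^ 2 := by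
        rw [← lintegral_indicator hω.measurableSet]
        refine lintegral_congr fun x => ?_
        by_cases hx : x ∈ ω <;> simp [hG, hx]

/-- Mollifications along a sequence of bump functions with radii tending to zero converge almost
everywhere. -/
theorem exists_mollifiers {R : ℝ} (hR : 0 < R) : ∃ φ : ℕ → ContDiffBump (0 : Plane),
    (∀ k, (φ k).rOut ≤ R) ∧ ∀ (ω : Set Plane) (f : Plane → Space), IsOpen ω →
      MemLp f 2 (volume.restrict ω) → ∀ᵐ x, x ∈ ω →
      Filter.Tendsto (fun k => mollify ω (φ k) f x) Filter.atTop (𝓝 (f x)) := by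
  have hr : ∀ k : ℕ, 0 < R / (k + 1) := fun k => by positivity
  refine ⟨fun k => ⟨R / (k + 1) / 2, R / (k + 1), half_pos (hr k), half_lt_self (hr k)⟩,
    fun k => ?_, fun ω f hω hf => ?_⟩
  · exact div_le_self hR.le (by linarith [(Nat.cast_nonneg k : (0 : ℝ) ≤ k)])
  · have := ContDiffBump.ae_convolution_tendsto_right_of_locallyIntegrable (μ := volume)
      (φ := fun k : ℕ => (⟨R / (k + 1) / 2, R / (k + 1), half_pos (hr k),
        half_lt_self (hr k)⟩ : ContDiffBump (0 : Plane))) (l := Filter.atTop) (K := 2)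
      (by simpa [Function.comp_def] using
        (tendsto_const_div_atTop_nhds_zero_nat R).comp (Filter.tendsto_add_atTop_nat 1))
      (Filter.Eventually.of_forall fun k => by
        show R / (k + 1) ≤ 2 * (R / (k + 1) / 2)
        linarith)
      (locallyIntegrable_indicator hω hf)
    filter_upwards [this] with x hx hxω
    simpa [hxω, mollify] using hx

/-! ### Averaging over segments across the interface -/

/-- The two-phase potential: the metric defect, truncated at `2 m` so as to be bounded, with
reference metric `A` on the side `{ψ > s}` and `B` on the side `{ψ < s}` of the line `{ψ = s}`. -/
def phasePotential (m : ℝ) (A B : Matrix (Fin 2) (Fin 2) ℝ) (ψ : Plane →L[ℝ] ℝ) (s : ℝ) (x : Plane)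
    (F : Fin 2 → Space) : ℝ :=
  if s < ψ x then min (metricDefect A F) (2 * m)
  else if ψ x < s then min (metricDefect B F) (2 * m) else 0

section
variable {m : ℝ} {A B : Matrix (Fin 2) (Fin 2) ℝ} {ψ : Plane →L[ℝ] ℝ} {s : ℝ}

theorem phasePotential_nonneg (hm : 0 < m) (x : Plane) (F : Fin 2 → Space) :
    0 ≤ phasePotential m A B ψ s x F := by
  have hA := metricDefect_nonneg A F
  have hB := metricDefect_nonneg B F
  unfold phasePotential
  split_ifs <;> positivity

theorem phasePotential_le (hm : 0 < m) (x : Plane) (F : Fin 2 → Space) :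
    phasePotential m A B ψ s x F ≤ 2 * m := by
  unfold phasePotential
  split_ifs
  · exact min_le_right _ _
  · exact min_le_right _ _
  · linarith

theorem continuous_phasePotential (x : Plane) : Continuous (phasePotential m A B ψ s x) := by
  have hA := continuous_metricDefect A
  have hB := continuous_metricDefect B
  unfold phasePotential
  split_ifs <;> fun_prop

theorem measurable_phasePotential {u : Plane → Fin 2 → Space} (hu : Measurable u) :
    Measurable fun x => phasePotential m A B ψ s x (u x) := by
  unfold phasePotential
  have hA := (continuous_metricDefect A).measurable.comp hu
  have hB := (continuous_metricDefect B).measurable.comp hu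
  have hψ : Measurable fun x => ψ x := ψ.continuous.measurable
  exact Measurable.ite (measurableSet_lt measurable_const hψ) (hA.min measurable_const)
    (Measurable.ite (measurableSet_lt hψ measurable_const) (hB.min measurable_const)
      measurable_const)

/-- On a line segment of half length `T` through the interface, at least one of the two phases is
far from its well where the segment crosses the interface, so that a transition has to occur on
that side. -/
theorem le_lintegral_segment {h η T : ℝ} (hm : 0 < m) (hh : 0 < h) (hT : 0 < T)
    (hAB : 8 * m ≤ frobeniusSq (A - B))
    (hA : ∀ F G, 2 * m ≤ metricDefect A F → metricDefect A G ≤ m → η ≤ dist F G)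
    (hB : ∀ F G, 2 * m ≤ metricDefect B F → metricDefect B G ≤ m → η ≤ dist F G)
    (hsmall : 2 * h * √m * η ≤ m * (T / 2)) {e : Plane} (he : ψ e = 1) {x : Plane}
    (hx : |ψ x - s| ≤ T / 2) {u u' : ℝ → Fin 2 → Space} (hu : ∀ t, HasDerivAt u (u' t) t)
    (hu' : Continuous u') :
    ENNReal.ofReal (2 * h * √m * η) ≤ ∫⁻ t in Ioo (-T) T,
      ENNReal.ofReal (phasePotential m A B ψ s (x + t • e) (u t) + h ^ 2 * ‖u' t‖ ^ 2) := by
  -- `p` is the parameter at which the segment crosses the interface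
  set p := s - ψ x with hp
  have hψ : ∀ t, ψ (x + t • e) = ψ x + t := fun t => by simp [he]
  obtain ⟨hx1, hx2⟩ := abs_le.1 hx
  have htr : ∀ C : Matrix (Fin 2) (Fin 2) ℝ,
      (∀ F G, 2 * m ≤ metricDefect C F → metricDefect C G ≤ m → η ≤ dist F G) →
      ∀ F G, 2 * m ≤ min (metricDefect C F) (2 * m) → min (metricDefect C G) (2 * m) ≤ m →
        η ≤ dist F G := by
    intro C hC F G hF hG
    refine hC F G (hF.trans (min_le_left _ _)) ?_
    exact (min_le_iff.1 hG).resolve_right (by linarith)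
  have hcases : 2 * m ≤ metricDefect A (u p) ∨ 2 * m ≤ metricDefect B (u p) := by
    by_contra! hlt
    have := frobeniusSq_sub_le A B ((Matrix.of fun k i => u p i k :
      Matrix (Fin 3) (Fin 2) ℝ).transpose * (Matrix.of fun k i => u p i k :
      Matrix (Fin 3) (Fin 2) ℝ))
    have h1 : frobeniusSq (A - B) ≤ 2 * metricDefect A (u p) + 2 * metricDefect B (u p) := this
    linarith [hlt.1, hlt.2]
  rcases hcases with hc | hc
  · have h1 := le_lintegral_of_transition (V := fun F => min (metricDefect A F) (2 * m))
      ((continuous_metricDefect A).min continuous_const) hm hh (htr A hA) hu hu' (a := p) (b := T)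
      (c := p) ⟨le_rfl, by linarith⟩ (le_min hc le_rfl)
    rw [min_eq_right (hsmall.trans (by gcongr; linarith))] at h1
    refine h1.trans ((setLIntegral_mono' measurableSet_Ioo fun t ht => ?_).trans
      (lintegral_mono_set (Ioo_subset_Ioo_left (by linarith))))
    have h2 : s < ψ (x + t • e) := by rw [hψ]; linarith [ht.1]
    simp only [phasePotential, if_pos h2, le_refl]
  · have h1 := le_lintegral_of_transition (V := fun F => min (metricDefect B F) (2 * m))
      ((continuous_metricDefect B).min continuous_const) hm hh (htr B hB) hu hu' (a := -T) (b := p)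
      (c := p) ⟨by linarith, le_rfl⟩ (le_min hc le_rfl)
    rw [min_eq_right (hsmall.trans (by gcongr; linarith))] at h1
    refine h1.trans ((setLIntegral_mono' measurableSet_Ioo fun t ht => ?_).trans
      (lintegral_mono_set (Ioo_subset_Ioo_right (by linarith))))
    have h2 : ψ (x + t • e) < s := by rw [hψ]; linarith [ht.2]
    simp only [phasePotential, if_neg (not_lt.2 h2.le), if_pos h2, le_refl]

end

/-- Averaging the bounds on all segments `x + [-T, T] e` with `x` in a small disc. -/
theorem volume_mul_le_of_segments {x₀ e : Plane} {R σ T : ℝ} (hσT : ∀ t ∈ Ioo (-T) T,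
    ∀ x ∈ ball x₀ σ, x + t • e ∈ ball x₀ R) {H : Plane → ℝ≥0∞} (hH : Measurable H) {c : ℝ≥0∞}
    (hc : ∀ x ∈ ball x₀ σ, c ≤ ∫⁻ t in Ioo (-T) T, H (x + t • e)) :
    c * volume (ball x₀ σ) ≤ ENNReal.ofReal (2 * T) * ∫⁻ x in ball x₀ R, H x := by
  calc c * volume (ball x₀ σ) = ∫⁻ x in ball x₀ σ, c := (setLIntegral_const _ _).symm
    _ ≤ ∫⁻ x in ball x₀ σ, ∫⁻ t in Ioo (-T) T, H (x + t • e) :=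
        setLIntegral_mono' measurableSet_ball hc
    _ = ∫⁻ t in Ioo (-T) T, ∫⁻ x in ball x₀ σ, H (x + t • e) := by
        refine lintegral_lintegral_swap ?_
        exact (hH.comp (by fun_prop : Measurable fun p : Plane × ℝ => p.1 + p.2 • e)).aemeasurable
    _ ≤ ∫⁻ t in Ioo (-T) T, ∫⁻ x in ball x₀ R, H x := by
        refine setLIntegral_mono' measurableSet_Ioo fun t ht => ?_
        rw [← lintegral_indicator measurableSet_ball, ← lintegral_indicator measurableSet_ball,
          ← lintegral_add_right_eq_self ((ball x₀ R).indicator H) (t • e)]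
        refine lintegral_mono fun x => ?_
        by_cases hx : x ∈ ball x₀ σ
        · simp [hx, hσT t ht x hx]
        · simp [hx]
    _ = _ := by
        rw [setLIntegral_const, Real.volume_Ioo, mul_comm]
        congr 2
        ring

/-- The lower bound for the truncated energy near the interface, valid for Sobolev maps by
approximation with mollified gradients. -/
theorem le_lintegral_phasePotential {ω : Set Plane} (hω : IsOpen ω) (y : SobolevMap ω)
    {m h η T σ s : ℝ}
    {A B : Matrix (Fin 2) (Fin 2) ℝ} {ψ : Plane →L[ℝ] ℝ} {x₀ : Plane} {R : ℝ} {j : Fin 2}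
    (hm : 0 < m) (hh : 0 < h) (hT : 0 < T) (hR : 0 < R) (hRω : closedBall x₀ (2 * R) ⊆ ω)
    (hAB : 8 * m ≤ frobeniusSq (A - B))
    (hA : ∀ F G, 2 * m ≤ metricDefect A F → metricDefect A G ≤ m → η ≤ dist F G)
    (hB : ∀ F G, 2 * m ≤ metricDefect B F → metricDefect B G ≤ m → η ≤ dist F G)
    (hsmall : 2 * h * √m * η ≤ m * (T / 2)) (hj : ψ (EuclideanSpace.single j 1) = 1)
    (hσ : ∀ x ∈ ball x₀ σ, |ψ x - s| ≤ T / 2) (hσT : σ + T ≤ R) :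
    ENNReal.ofReal (2 * h * √m * η) * volume (ball x₀ σ) ≤ ENNReal.ofReal (2 * T) *
      ((∫⁻ x in ball x₀ R, ENNReal.ofReal (phasePotential m A B ψ s x fun i => y.d i x)) +
        ENNReal.ofReal (h ^ 2) * ∑ i, ∫⁻ x in ω, ‖y.dd i j x‖ₑ ^ 2) := by
  set e : Plane := EuclideanSpace.single j 1
  -- the bounds on segments hold for the smooth gradients `u k`, and only their potential part has
  -- to be passed to the limit, because mollification decreases the `L²` norm of the derivatives
  obtain ⟨φ, hφR, hφ⟩ := exists_mollifiers hR
  set u : ℕ → Plane → Fin 2 → Space := fun k x i => mollify ω (φ k) (y.d i) x with hu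
  set u' : ℕ → Plane → Fin 2 → Space := fun k x i => fderiv ℝ (mollify ω (φ k) (y.d i)) x e with hu'
  have hC1 : ∀ k i, ContDiff ℝ 1 (mollify ω (φ k) (y.d i)) := fun k i =>
    contDiff_mollify hω (φ k) (y.memLp_d i)
  have hucont : ∀ k, Continuous (u k) := fun k => continuous_pi fun i => (hC1 k i).continuous
  have hu'cont : ∀ k, Continuous (u' k) := fun k => continuous_pi fun i =>
    ((hC1 k i).continuous_fderiv one_ne_zero).clm_apply continuous_const
  have hball : ∀ t ∈ Ioo (-T) T, ∀ x ∈ ball x₀ σ, x + t • e ∈ ball x₀ R := by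
    intro t ht x hx
    rw [mem_ball, dist_eq_norm] at hx ⊢
    have h1 : ‖t • e‖ < T := by
      simpa [e, norm_smul] using abs_lt.2 ht
    calc ‖x + t • e - x₀‖ = ‖(x - x₀) + t • e‖ := by congr 1; abel
      _ ≤ ‖x - x₀‖ + ‖t • e‖ := norm_add_le _ _
      _ < R := by linarith
  have hstep : ∀ k, ENNReal.ofReal (2 * h * √m * η) * volume (ball x₀ σ) ≤ ENNReal.ofReal (2 * T) *
      ((∫⁻ x in ball x₀ R, ENNReal.ofReal (phasePotential m A B ψ s x (u k x))) +
        ENNReal.ofReal (h ^ 2) * ∑ i, ∫⁻ x in ω, ‖y.dd i j x‖ₑ ^ 2) := by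
    intro k
    have hmeas1 : Measurable fun x => ENNReal.ofReal (phasePotential m A B ψ s x (u k x)) :=
      (measurable_phasePotential (hucont k).measurable).ennreal_ofReal
    have hmeas : Measurable fun x => ENNReal.ofReal
        (phasePotential m A B ψ s x (u k x) + h ^ 2 * ‖u' k x‖ ^ 2) :=
      ((measurable_phasePotential (hucont k).measurable).add
        (((hu'cont k).norm.pow 2).measurable.const_mul _)).ennreal_ofReal
    refine (volume_mul_le_of_segments hball hmeas fun x hx => ?_).trans ?_
    · refine le_lintegral_segment hm hh hT hAB hA hB hsmall hj (hσ x hx)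
        (u := fun t => u k (x + t • e)) (u' := fun t => u' k (x + t • e)) (fun t => ?_)
        ((hu'cont k).comp (by fun_prop))
      refine hasDerivAt_pi.2 fun i => ?_
      have h1 : HasDerivAt (fun t : ℝ => x + t • e) e t := by
        simpa using ((hasDerivAt_id t).smul_const e).const_add x
      exact (((hC1 k i).differentiable one_ne_zero) _).hasFDerivAt.comp_hasDerivAt t h1
    · gcongr
      calc ∫⁻ x in ball x₀ R, ENNReal.ofReal
            (phasePotential m A B ψ s x (u k x) + h ^ 2 * ‖u' k x‖ ^ 2)
          ≤ ∫⁻ x in ball x₀ R, (ENNReal.ofReal (phasePotential m A B ψ s x (u k x)) +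
              ENNReal.ofReal (h ^ 2) * ∑ i, ‖mollify ω (φ k) (y.dd i j) x‖ₑ ^ 2) := by
            refine setLIntegral_mono' measurableSet_ball fun x hx => ?_
            rw [ENNReal.ofReal_add (phasePotential_nonneg hm _ _) (by positivity),
              ENNReal.ofReal_mul (by positivity)]
            gcongr
            have hx' : closedBall x (φ k).rOut ⊆ ω := by
              refine Subset.trans (fun z hz => ?_) hRω
              rw [mem_closedBall] at hz ⊢
              rw [mem_ball] at hx
              linarith [dist_triangle z x x₀, hφR k]
            have hui : ∀ i, u' k x i = mollify ω (φ k) (y.dd i j) x := fun i =>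
              fderiv_mollify hω (y.memLp_d i) (y.isWeakPartial_dd i j) (φ k) hx'
            have hsum : ‖u' k x‖ ^ 2 ≤ ∑ i, ‖u' k x i‖ ^ 2 := by
              rw [← Real.le_sqrt (norm_nonneg _), pi_norm_le_iff_of_nonneg (Real.sqrt_nonneg _)]
              · intro i
                exact Real.le_sqrt_of_sq_le (Finset.single_le_sum (f := fun i => ‖u' k x i‖ ^ 2)
                  (fun _ _ => sq_nonneg _) (Finset.mem_univ i))
              · exact Finset.sum_nonneg fun _ _ => sq_nonneg _
            calc ENNReal.ofReal (‖u' k x‖ ^ 2) ≤ ENNReal.ofReal (∑ i, ‖u' k x i‖ ^ 2) :=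
                  ENNReal.ofReal_le_ofReal hsum
              _ = _ := by
                  rw [ENNReal.ofReal_sum_of_nonneg fun _ _ => by positivity]
                  refine Finset.sum_congr rfl fun i _ => ?_
                  rw [ENNReal.ofReal_pow (norm_nonneg _), ofReal_norm, hui]
        _ = (∫⁻ x in ball x₀ R, ENNReal.ofReal (phasePotential m A B ψ s x (u k x))) +
              ENNReal.ofReal (h ^ 2) *
                ∑ i, ∫⁻ x in ball x₀ R, ‖mollify ω (φ k) (y.dd i j) x‖ₑ ^ 2 := by
            have hmm : ∀ i, Measurable fun x => ‖mollify ω (φ k) (y.dd i j) x‖ₑ ^ 2 := fun i =>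
              ((contDiff_mollify hω (φ k) (y.memLp_dd i j)).continuous.enorm.measurable).pow_const 2
            rw [lintegral_add_left hmeas1, lintegral_const_mul' _ _ ENNReal.ofReal_ne_top,
              lintegral_finsetSum _ fun i _ => hmm i]
        _ ≤ _ := by
            refine add_le_add_right (mul_le_mul_right (Finset.sum_le_sum fun i _ => ?_) _) _
            exact (setLIntegral_le_lintegral _ _).trans
              (lintegral_mollify_sq_le hω (y.memLp_dd i j) (φ k))
  have hlim : Filter.Tendsto (fun k => ∫⁻ x in ball x₀ R,
      ENNReal.ofReal (phasePotential m A B ψ s x (u k x))) Filter.atTop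
      (𝓝 (∫⁻ x in ball x₀ R, ENNReal.ofReal (phasePotential m A B ψ s x fun i => y.d i x))) := by
    refine tendsto_lintegral_of_dominated_convergence (fun _ => ENNReal.ofReal (2 * m))
      (fun k => (measurable_phasePotential (hucont k).measurable).ennreal_ofReal)
      (fun k => Filter.Eventually.of_forall fun x =>
        ENNReal.ofReal_le_ofReal (phasePotential_le hm _ _)) ?_ ?_
    · rw [setLIntegral_const]
      exact ENNReal.mul_ne_top ENNReal.ofReal_ne_top measure_ball_lt_top.ne
    · have hae : ∀ᵐ x, ∀ i, x ∈ ω →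
          Filter.Tendsto (fun k => mollify ω (φ k) (y.d i) x) Filter.atTop (𝓝 (y.d i x)) :=
        ae_all_iff.2 fun i => hφ ω (y.d i) hω (y.memLp_d i)
      filter_upwards [ae_restrict_of_ae hae, ae_restrict_mem measurableSet_ball] with x hx hxR
      have hxω : x ∈ ω := hRω (ball_subset_closedBall (ball_subset_ball (by linarith) hxR))
      have h1 : Filter.Tendsto (fun k => u k x) Filter.atTop (𝓝 fun i => y.d i x) :=
        tendsto_pi_nhds.2 fun i => hx i hxω
      exact (ENNReal.continuous_ofReal.tendsto _).comp
        (((continuous_phasePotential x).tendsto _).comp h1)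
  refine ge_of_tendsto' (ENNReal.Tendsto.const_mul (hlim.add tendsto_const_nhds)
    (Or.inr ENNReal.ofReal_ne_top)) hstep

/-- The energy controls the potential near the interface together with the second derivatives
in one coordinate direction. -/
theorem mul_le_plateEnergy {ω : Set Plane} (y : SobolevMap ω) {r m h s R : ℝ}
    {n₀ : Plane → Space} {n n' : Space} {ψ : Plane →L[ℝ] ℝ} {x₀ : Plane} (j : Fin 2)
    (hRω : ball x₀ R ⊆ ω) (hn : ∀ x ∈ ball x₀ R, s < ψ x → n₀ x = n)
    (hn' : ∀ x ∈ ball x₀ R, ψ x < s → n₀ x = n') :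
    ENNReal.ofReal h * ((∫⁻ x in ball x₀ R, ENNReal.ofReal (phasePotential m (midplaneMetric r n)
        (midplaneMetric r n') ψ s x fun i => y.d i x)) +
      ENNReal.ofReal (h ^ 2) * ∑ i, ∫⁻ x in ω, ‖y.dd i j x‖ₑ ^ 2) ≤ plateEnergy r n₀ h y := by
  unfold plateEnergy
  gcongr
  have hmeas : ∀ i, AEMeasurable (fun x => ‖y.dd i j x‖ₑ ^ 2) (volume.restrict ω) := fun i =>
    (y.memLp_dd i j).1.enorm.pow_const 2
  rw [← inter_eq_self_of_subset_left hRω, ← Measure.restrict_restrict measurableSet_ball,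
    ← lintegral_indicator measurableSet_ball, ← lintegral_finsetSum' _ fun i _ => hmeas i,
    ← lintegral_const_mul' _ _ ENNReal.ofReal_ne_top,
    ← lintegral_add_right' _ ((Finset.aemeasurable_fun_sum _ fun i _ => hmeas i).const_mul _)]
  refine lintegral_mono fun x => ?_
  have hhess : ∑ i, ‖y.dd i j x‖ₑ ^ 2 ≤ ENNReal.ofReal (y.hessSq x) := by
    have h1 : ∑ i, ‖y.dd i j x‖ₑ ^ 2 = ENNReal.ofReal (∑ i, ‖y.dd i j x‖ ^ 2) := by
      rw [ENNReal.ofReal_sum_of_nonneg fun _ _ => by positivity]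
      simp_rw [ENNReal.ofReal_pow (norm_nonneg _), ofReal_norm]
    rw [h1]
    apply ENNReal.ofReal_le_ofReal
    refine Finset.sum_le_sum fun i _ => ?_
    rw [EuclideanSpace.real_norm_sq_eq]
    exact Finset.single_le_sum (f := fun j => ∑ k, y.dd i j x k ^ 2)
      (fun _ _ => Finset.sum_nonneg fun _ _ => sq_nonneg _) (Finset.mem_univ j)
  have hhess0 : 0 ≤ y.hessSq x := Finset.sum_nonneg fun _ _ => Finset.sum_nonneg fun _ _ =>
    Finset.sum_nonneg fun _ _ => sq_nonneg _
  rw [ENNReal.ofReal_add (frobeniusSq_nonneg _) (by positivity),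
    ENNReal.ofReal_mul (by positivity)]
  gcongr
  by_cases hx : x ∈ ball x₀ R
  · rw [indicator_of_mem hx]
    apply ENNReal.ofReal_le_ofReal
    unfold phasePotential
    split_ifs with h1 h2
    · rw [hn x hx h1]; exact min_le_left _ _
    · rw [hn' x hx h2]; exact min_le_left _ _
    · exact frobeniusSq_nonneg _
  · rw [indicator_of_notMem hx]
    exact zero_le

theorem theorem1p8 (r : ℝ) (hr : 0 < r) (hr1 : r ≠ 1) (ω : Set Plane) (n₀ : Plane → Space)
    (hdesign : IsNonisometricOrigamiDesign ω n₀) :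
    ∃ cL : ℝ, 0 < cL ∧ ∃ h₀ : ℝ, 0 < h₀ ∧ ∀ h : ℝ, 0 < h → h < h₀ →
      ENNReal.ofReal (cL * h ^ 2) ≤ ⨅ y : SobolevMap ω, plateEnergy r n₀ h y := by
  obtain ⟨x₀, ρ, j, ψ, n, n', hρ, hρω, hj, hne, hne', hn, hn'⟩ := hdesign.exists_half_balls
  set A := midplaneMetric r n
  set B := midplaneMetric r n'
  have hAB : 0 < frobeniusSq (A - B) :=
    frobeniusSq_pos (sub_ne_zero.2 (midplaneMetric_ne hr hr1 hne hne'))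
  set m := frobeniusSq (A - B) / 8 with hmdef
  have hm : 0 < m := by positivity
  obtain ⟨η₁, hη₁, hA⟩ := exists_transition_cost A hm
  obtain ⟨η₂, hη₂, hB⟩ := exists_transition_cost B hm
  set η := min η₁ η₂
  have hη : 0 < η := lt_min hη₁ hη₂
  -- the energy is estimated on the disc of radius `R`; mollifiers of radius at most `R` evaluated
  -- there see the disc of radius `2 R` only
  set R := ρ / 3 with hRdef
  have hR : 0 < R := by positivity
  set T := R / 2 with hTdef
  have hT : 0 < T := by positivity
  set σ := T / (2 * (‖ψ‖ + 1)) with hσdef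
  have hψ0 := norm_nonneg ψ
  have hσ : 0 < σ := by positivity
  have hσle : σ * (‖ψ‖ + 1) = T / 2 := by rw [hσdef]; field_simp
  have hσψ : ∀ x ∈ ball x₀ σ, |ψ x - ψ x₀| ≤ T / 2 := by
    intro x hx
    rw [mem_ball, dist_eq_norm] at hx
    rw [← map_sub, ← Real.norm_eq_abs]
    calc ‖ψ (x - x₀)‖ ≤ ‖ψ‖ * ‖x - x₀‖ := ψ.le_opNorm _
      _ ≤ (‖ψ‖ + 1) * σ := by gcongr; linarith
      _ = T / 2 := by rw [mul_comm, hσle]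
  have hσT : σ + T ≤ R := by nlinarith
  set v := (volume (ball x₀ σ)).toReal with hvdef
  have hvtop : volume (ball x₀ σ) ≠ ∞ := measure_ball_lt_top.ne
  have hv : 0 < v := ENNReal.toReal_pos (measure_ball_pos volume x₀ hσ).ne' hvtop
  have hvol : volume (ball x₀ σ) = ENNReal.ofReal v := (ENNReal.ofReal_toReal hvtop).symm
  have hsm : 0 < √m := Real.sqrt_pos.2 hm
  refine ⟨2 * √m * η * v / (2 * T), by positivity, m * (T / 2) / (2 * √m * η), by positivity,
    fun h hh hh₀ => le_iInf fun y => ?_⟩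
  have hsmall : 2 * h * √m * η ≤ m * (T / 2) := by
    rw [lt_div_iff₀ (by positivity)] at hh₀
    linarith
  have hRρ : closedBall x₀ (2 * R) ⊆ ω := (closedBall_subset_ball (by linarith)).trans hρω
  have hball : ball x₀ R ⊆ ball x₀ ρ := ball_subset_ball (by linarith)
  have h1 := le_lintegral_phasePotential hdesign.isOpen y hm hh hT hR hRρ (by linarith)
    (fun F G hF hG => (min_le_left _ _).trans (hA F G hF hG))
    (fun F G hF hG => (min_le_right _ _).trans (hB F G hF hG)) hsmall hj hσψ hσT
  have h2 := mul_le_plateEnergy (r := r) (m := m) (h := h) y j (hball.trans hρω)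
    (fun x hx => hn x (hball hx)) (fun x hx => hn' x (hball hx))
  refine le_trans ?_ h2
  have hTpos : 0 < ENNReal.ofReal (2 * T) := ENNReal.ofReal_pos.2 (by positivity)
  have h3 := ENNReal.div_le_of_le_mul' h1
  rw [hvol, ← ENNReal.ofReal_mul (by positivity), ← ENNReal.ofReal_div_of_pos (by positivity)] at h3
  calc ENNReal.ofReal (2 * √m * η * v / (2 * T) * h ^ 2)
      = ENNReal.ofReal h * ENNReal.ofReal (2 * h * √m * η * v / (2 * T)) := by
        rw [← ENNReal.ofReal_mul hh.le]
        congr 1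
        ring
    _ ≤ _ := by gcongr

end
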